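/- Let $d\ge 1$ and let $K\subset\mathbb R^d$ be a $d$-dimensional convex polytope (the convex hull of a finite set of points whose affine hull is $\mathbb R^d$). Let $V$ be the set of its vertices and $F$ the set of its facets, i.e. the faces (intersections of $K$ with supporting hyperplanes) of dimension $0$ and $d-1$, respectively. For $v\in V$ let $F_v=\{f\in F: v\in f\}$. Suppose that $K$ is non-degenerate (no two distinct facets that meet lie in the same hyperplane) and simple ($|F_v|=d$ for every $v\in V$). For $f\in F$ let $n_f$ be the unit outward normal vector of $K$ on $f$, and let $h_f(x)$ be the distance from $x$ to the hyperplane containing $f$. Let $h_K$ be the diameter of $K$ and $$h_*=\min\{h_f(v) : f\in F,\ v\in V,\ v\notin f\}.$$ For $v\in V$ let $\det(M_v)>0$ be the absolute value of the determinant of the $d\times d$ matrix whose columns are the vectors $n_f$, $f\in F_v$ (this does not depend on the order of the columns), and let $$W(x)=\sum_{v\in V}\det(M_v)\prod_{f\in F\setminus F_v}h_f(x).$$ Then for every $x\in K$: 1. $$W(x)\ \ge\ \frac{h_*^{|F|}}{(d+1)^{|F|-d}\,h_K^{d}};$$ 2. at most $d$ facets $f\in F$ satisfy $h_f(x)<\frac{h_*}{d+1}$;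 3. there is a vertex $v\in V$ that lies on every facet $f\in F$ with $h_f(x)<\frac{h_*}{d+1}$. -/

import Mathlib

open scoped RealInnerProductSpace

noncomputable section

namespace WachspressPolytope

variable {d : ℕ}

/-- `K` is a `d`-dimensional convex polytope in `ℝ^d`: the convex hull of a finite set of points
whose affine hull is the whole space. -/
structure IsConvexPolytope (K : Set (EuclideanSpace ℝ (Fin d))) : Prop where
  exists_finite : ∃ S : Set (EuclideanSpace ℝ (Fin d)), S.Finite ∧ K = convexHull ℝ S
  affineSpan_eq_top : affineSpan ℝ K = ⊤

/-- The vertices of `K`, i.e. its `0`-dimensional faces: the points `v` such that `{v}` is the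
intersection of `K` with a supporting hyperplane. -/
def vertices (K : Set (EuclideanSpace ℝ (Fin d))) : Set (EuclideanSpace ℝ (Fin d)) :=
  K.exposedPoints ℝ

/-- The facets of `K`: the nonempty intersections of `K` with a supporting hyperplane which have
dimension `d - 1`. (The only degenerate "supporting hyperplane" allowed by `IsExposed`, the zero
functional, exposes `K` itself, whose dimension is `d`.) -/
def facets (K : Set (EuclideanSpace ℝ (Fin d))) : Set (Set (EuclideanSpace ℝ (Fin d))) :=
  {f | IsExposed ℝ K f ∧ f.Nonempty ∧ Module.finrank ℝ (vectorSpan ℝ f) + 1 = d}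

/-- `F_v`, the facets of `K` incident to `v`. -/
def facetsAt (K : Set (EuclideanSpace ℝ (Fin d))) (v : EuclideanSpace ℝ (Fin d)) :
    Set (Set (EuclideanSpace ℝ (Fin d))) :=
  {f ∈ facets K | v ∈ f}

/-- `K` is non-degenerate: two different facets that meet do not lie in the same hyperplane. -/
def IsNondegenerate (K : Set (EuclideanSpace ℝ (Fin d))) : Prop :=
  ∀ f ∈ facets K, ∀ g ∈ facets K, f ≠ g → (f ∩ g).Nonempty → affineSpan ℝ f ≠ affineSpan ℝ g

/-- `K` is simple: each vertex is incident to exactly `d` facets. -/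
def IsSimple (K : Set (EuclideanSpace ℝ (Fin d))) : Prop :=
  ∀ v ∈ vertices K, (facetsAt K v).encard = d

/-- `h_f(x)`, the distance from `x` to the hyperplane containing the facet `f`. -/
def facetDist (f : Set (EuclideanSpace ℝ (Fin d))) (x : EuclideanSpace ℝ (Fin d)) : ℝ :=
  Metric.infDist x (affineSpan ℝ f : Set (EuclideanSpace ℝ (Fin d)))

/-- `h_*`, the minimal distance between a vertex and (the hyperplane of) a non-incident facet. -/
def hStar (K : Set (EuclideanSpace ℝ (Fin d))) : ℝ :=
  sInf {r : ℝ | ∃ f ∈ facets K, ∃ v ∈ vertices K, v ∉ f ∧ r = facetDist f v}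

/-- `n` is a unit vector orthogonal to `f` and pointing out of `K` along `f`. -/
def IsUnitOutwardNormal (K f : Set (EuclideanSpace ℝ (Fin d))) (n : EuclideanSpace ℝ (Fin d)) :
    Prop :=
  ‖n‖ = 1 ∧ (∀ x ∈ f, ∀ y ∈ f, ⟪n, y - x⟫ = 0) ∧ ∀ x ∈ f, ∀ y ∈ K, ⟪n, y - x⟫ ≤ 0

/-- `n_f`, the (unique) unit outward normal vector of `K` on the facet `f`. -/
def unitOutwardNormal (K f : Set (EuclideanSpace ℝ (Fin d))) : EuclideanSpace ℝ (Fin d) :=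
  Classical.epsilon (IsUnitOutwardNormal K f)

/-- The matrix `[n_{f_1}, …, n_{f_d}]` whose columns are the unit outward normals of the facets
incident to `v`, listed in the order `e`. -/
def normalMatrix (K : Set (EuclideanSpace ℝ (Fin d))) (v : EuclideanSpace ℝ (Fin d))
    (e : Fin d ≃ facetsAt K v) : Matrix (Fin d) (Fin d) ℝ :=
  Matrix.of fun i j => unitOutwardNormal K (e j : Set (EuclideanSpace ℝ (Fin d))) i

open Classical in
/-- `det(M_v)`, with the sign normalised to be nonnegative: the absolute value of the determinant
of the matrix of unit outward normals of the `d` facets at `v`, in any order. -/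
def detM (K : Set (EuclideanSpace ℝ (Fin d))) (v : EuclideanSpace ℝ (Fin d)) : ℝ :=
  if h : Nonempty (Fin d ≃ facetsAt K v) then |(normalMatrix K v h.some).det| else 0

/-- `detM` does not depend on the order of the facets. -/
theorem detM_eq (K : Set (EuclideanSpace ℝ (Fin d))) (v : EuclideanSpace ℝ (Fin d))
    (e : Fin d ≃ facetsAt K v) : detM K v = |(normalMatrix K v e).det| := by
  have h : Nonempty (Fin d ≃ facetsAt K v) := ⟨e⟩
  have key : normalMatrix K v e =
      (normalMatrix K v h.some).submatrix id (e.trans h.some.symm) := by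
    ext i j
    simp [normalMatrix]
  rw [detM, dif_pos h, key, Matrix.det_permute', abs_mul]
  rcases Int.units_eq_one_or (Equiv.Perm.sign (e.trans h.some.symm)) with hs | hs <;> simp [hs]

/-- The weight `w_v(x) = det(M_v) ∏_{f ∈ F \ F_v} h_f(x)`. -/
def weight (K : Set (EuclideanSpace ℝ (Fin d))) (v x : EuclideanSpace ℝ (Fin d)) : ℝ :=
  detM K v * ∏ᶠ f ∈ facets K \ facetsAt K v, facetDist f x

/-- The Wachspress denominator `W(x) = ∑_{v ∈ V} w_v(x)`. -/
def wachspressW (K : Set (EuclideanSpace ℝ (Fin d))) (x : EuclideanSpace ℝ (Fin d)) : ℝ :=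
  ∑ᶠ v ∈ vertices K, weight K v x

/-- The sum over the vertices is a finite sum. -/
theorem IsConvexPolytope.finite_vertices {K : Set (EuclideanSpace ℝ (Fin d))}
    (hK : IsConvexPolytope K) : (vertices K).Finite := by
  obtain ⟨S, hS, rfl⟩ := hK.exists_finite
  exact hS.subset
    ((exposedPoints_subset_extremePoints (𝕜 := ℝ)).trans
      (extremePoints_convexHull_subset (𝕜 := ℝ)))

/-- The product over the facets is a finite product. -/
theorem IsConvexPolytope.finite_facets {K : Set (EuclideanSpace ℝ (Fin d))}
    (hK : IsConvexPolytope K) : (facets K).Finite := by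
  obtain ⟨S, hS, rfl⟩ := hK.exists_finite
  have hc : IsCompact (convexHull ℝ S) := hS.isCompact_convexHull (𝕜 := ℝ)
  have hcv : Convex ℝ (convexHull ℝ S) := convex_convexHull ℝ S
  have key : ∀ f ∈ facets (convexHull ℝ S), f = closure (convexHull ℝ (f ∩ S)) := by
    rintro f ⟨hf, -, -⟩
    have hfc : IsCompact f := hf.isCompact hc
    have hfv : Convex ℝ f := hf.convex hcv
    apply Set.Subset.antisymm
    · conv_lhs => rw [← closure_convexHull_extremePoints hfc hfv]
      refine closure_mono (convexHull_mono fun x hx => ⟨hx.1, ?_⟩)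
      exact extremePoints_convexHull_subset (𝕜 := ℝ) (hf.isExtreme.extremePoints_subset_extremePoints hx)
    · exact closure_minimal (convexHull_min Set.inter_subset_left hfv) hfc.isClosed
  refine (hS.finite_subsets.image fun T => closure (convexHull ℝ T)).subset fun f hf => ?_
  exact ⟨f ∩ S, Set.inter_subset_right, (key f hf).symm⟩

end WachspressPolytope

end

noncomputable section

namespace WachspressPolytope

variable {d : ℕ} {K f : Set (EuclideanSpace ℝ (Fin d))}

/-! By Carathéodory, `x` is a convex combination of at most `d + 1` vertices, so some vertex `v` has
coefficient at least `1 / (d + 1)`. On `K` the distance to a facet hyperplane is affine and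
nonnegative, hence every facet missing `v` is at distance at least `hStar K / (d + 1)` from `x`
(`exists_vertex_forall_le_facetDist`). All near facets therefore pass through `v`, and simplicity
leaves at most `d` of them.

For the bound on `W`, keep only the term of `v`. Its product is controlled by the same estimate, and
what remains is `hStar K ^ d ≤ detM K v * diam K ^ d` (`hStar_pow_le_detM_mul`). Pairing the normals
at `v` with the vectors from `v` to its neighbours gives a diagonal matrix whose entries are at
least `hStar K` in absolute value, while Hadamard's inequality bounds the determinant of those
vectors. The neighbours exist because `K` is cut out by its facet inequalities
(`exists_facet_of_notMem`). -/

theorem IsConvexPolytope.isCompact (hK : IsConvexPolytope K) : IsCompact K := by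
  obtain ⟨S, hS, rfl⟩ := hK.exists_finite
  exact hS.isCompact_convexHull (𝕜 := ℝ)

theorem IsConvexPolytope.convex (hK : IsConvexPolytope K) : Convex ℝ K := by
  obtain ⟨S, -, rfl⟩ := hK.exists_finite
  exact convex_convexHull ℝ S

theorem IsConvexPolytope.interior_nonempty (hK : IsConvexPolytope K) : (interior K).Nonempty :=
  hK.convex.interior_nonempty_iff_affineSpan_eq_top.2 hK.affineSpan_eq_top

/-! ### Facet normals, offsets and distances -/

/-- A facet of `K` is cut out of `K` by a nonzero linear functional. -/
theorem exists_functional_of_mem_facets (hK : IsConvexPolytope K) (hf : f ∈ facets K) :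
    ∃ l : StrongDual ℝ (EuclideanSpace ℝ (Fin d)), l ≠ 0 ∧
      f = {x ∈ K | ∀ y ∈ K, l y ≤ l x} := by
  obtain ⟨hexp, hne, hdim⟩ := hf
  obtain ⟨l, hl⟩ := hexp hne
  refine ⟨l, ?_, hl⟩
  rintro rfl
  have hfK : f = K := by rw [hl]; simp
  rw [hfK, ← direction_affineSpan, hK.affineSpan_eq_top, AffineSubspace.direction_top,
    finrank_top, finrank_euclideanSpace_fin] at hdim
  omega

theorem exists_isUnitOutwardNormal (hK : IsConvexPolytope K) (hf : f ∈ facets K) :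
    ∃ n, IsUnitOutwardNormal K f n := by
  obtain ⟨l, hl0, hl⟩ := exists_functional_of_mem_facets hK hf
  set w := (InnerProductSpace.toDual ℝ (EuclideanSpace ℝ (Fin d))).symm l with hw
  have hwl : ∀ y, ⟪w, y⟫ = l y := fun y => by simp [hw]
  have hw0 : w ≠ 0 := by simpa [hw] using hl0
  have hwn : 0 < ‖w‖ := norm_pos_iff.2 hw0
  refine ⟨‖w‖⁻¹ • w, ?_, fun x hx y hy => ?_, fun x hx y hy => ?_⟩
  · rw [norm_smul, norm_inv, norm_norm, inv_mul_cancel₀ hwn.ne']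
  · rw [hl] at hx hy
    rw [real_inner_smul_left, hwl, map_sub, le_antisymm (hx.2 y hy.1) (hy.2 x hx.1)]
    simp
  · rw [hl] at hx
    rw [real_inner_smul_left, hwl, map_sub]
    exact mul_nonpos_of_nonneg_of_nonpos (by positivity) (by linarith [hx.2 y hy])

theorem isUnitOutwardNormal_unitOutwardNormal (hK : IsConvexPolytope K) (hf : f ∈ facets K) :
    IsUnitOutwardNormal K f (unitOutwardNormal K f) :=
  Classical.epsilon_spec (exists_isUnitOutwardNormal hK hf)

theorem norm_unitOutwardNormal (hK : IsConvexPolytope K) (hf : f ∈ facets K) :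
    ‖unitOutwardNormal K f‖ = 1 :=
  (isUnitOutwardNormal_unitOutwardNormal hK hf).1

/-- The value on the facet `f` of the linear functional given by its unit outward normal. -/
def facetOffset (K f : Set (EuclideanSpace ℝ (Fin d))) : ℝ :=
  sSup ((fun y => ⟪unitOutwardNormal K f, y⟫) '' K)

theorem subset_of_mem_facets (hf : f ∈ facets K) : f ⊆ K := hf.1.subset

theorem inner_eq_facetOffset (hK : IsConvexPolytope K) (hf : f ∈ facets K)
    {p : EuclideanSpace ℝ (Fin d)} (hp : p ∈ f) :
    ⟪unitOutwardNormal K f, p⟫ = facetOffset K f := by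
  refine (IsGreatest.csSup_eq ⟨Set.mem_image_of_mem _ (subset_of_mem_facets hf hp), ?_⟩).symm
  rintro _ ⟨y, hy, rfl⟩
  have := (isUnitOutwardNormal_unitOutwardNormal hK hf).2.2 p hp y hy
  rw [inner_sub_right] at this
  simpa using this

theorem inner_le_facetOffset (hK : IsConvexPolytope K) (hf : f ∈ facets K)
    {y : EuclideanSpace ℝ (Fin d)} (hy : y ∈ K) :
    ⟪unitOutwardNormal K f, y⟫ ≤ facetOffset K f := by
  obtain ⟨p, hp⟩ := hf.2.1
  have := (isUnitOutwardNormal_unitOutwardNormal hK hf).2.2 p hp y hy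
  rw [inner_sub_right, inner_eq_facetOffset hK hf hp] at this
  linarith

/-- The affine hull of a facet is the hyperplane given by its normal and offset. -/
theorem mem_affineSpan_facet_iff (hK : IsConvexPolytope K) (hf : f ∈ facets K)
    {y : EuclideanSpace ℝ (Fin d)} :
    y ∈ affineSpan ℝ f ↔ ⟪unitOutwardNormal K f, y⟫ = facetOffset K f := by
  have hn := isUnitOutwardNormal_unitOutwardNormal hK hf
  set n := unitOutwardNormal K f with hndef
  have hn0 : n ≠ 0 := by
    intro h
    have := hn.1
    rw [h] at this
    simp at this
  obtain ⟨p, hp⟩ := hf.2.1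
  -- The direction of `f` lies in the orthogonal complement of `n`, and both have dimension `d - 1`.
  have hspan : vectorSpan ℝ f = (ℝ ∙ n)ᗮ := by
    refine Submodule.eq_of_le_of_finrank_eq ?_ ?_
    · rw [vectorSpan_def, Submodule.span_le]
      rintro _ ⟨a, ha, b, hb, rfl⟩
      exact Submodule.mem_orthogonal_singleton_iff_inner_right.2 (hn.2.1 b hb a ha)
    · have h1 := Submodule.finrank_add_finrank_orthogonal (ℝ ∙ n)
      rw [finrank_span_singleton hn0, finrank_euclideanSpace_fin] at h1
      have h2 := hf.2.2
      omega
  rw [← AffineSubspace.vsub_right_mem_direction_iff_mem (mem_affineSpan ℝ hp),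
    direction_affineSpan, hspan, Submodule.mem_orthogonal_singleton_iff_inner_right,
    vsub_eq_sub, inner_sub_right, hndef, inner_eq_facetOffset hK hf hp, sub_eq_zero]

theorem inner_eq_facetOffset_iff (hK : IsConvexPolytope K) (hf : f ∈ facets K)
    {y : EuclideanSpace ℝ (Fin d)} (hy : y ∈ K) :
    ⟪unitOutwardNormal K f, y⟫ = facetOffset K f ↔ y ∈ f := by
  refine ⟨fun h => ?_, inner_eq_facetOffset hK hf⟩
  obtain ⟨l, -, hl⟩ := exists_functional_of_mem_facets hK hf
  obtain ⟨p, hp⟩ := hf.2.1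
  -- The exposing functional `l` is constant on `f`, hence on its affine hull, so a point of `K` in
  -- that hull also maximizes `l`.
  have hle : affineSpan ℝ f ≤ (affineSpan ℝ {l p}).comap l.toLinearMap.toAffineMap := by
    refine affineSpan_le.2 fun z hz => ?_
    have hz' := hz
    have hp' := hp
    rw [hl] at hz' hp'
    simpa using le_antisymm (hp'.2 z hz'.1) (hz'.2 p hp'.1)
  have hy' := hle ((mem_affineSpan_facet_iff hK hf).2 h)
  have hyp : l y = l p := by simpa using hy'
  rw [hl] at hp ⊢
  exact ⟨hy, fun z hz => hyp ▸ hp.2 z hz⟩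

theorem facetDist_eq_abs (hK : IsConvexPolytope K) (hf : f ∈ facets K)
    (y : EuclideanSpace ℝ (Fin d)) :
    facetDist f y = |facetOffset K f - ⟪unitOutwardNormal K f, y⟫| := by
  have hn := norm_unitOutwardNormal hK hf
  set n := unitOutwardNormal K f with hndef
  have hnn : ⟪n, n⟫ = 1 := by rw [real_inner_self_eq_norm_sq, hn]; norm_num
  refine le_antisymm ?_ ?_
  · have hmem : y + (facetOffset K f - ⟪n, y⟫) • n ∈ affineSpan ℝ f := by
      rw [mem_affineSpan_facet_iff hK hf, ← hndef, inner_add_right, real_inner_smul_right, hnn]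
      ring
    refine (Metric.infDist_le_dist_of_mem hmem).trans_eq ?_
    rw [dist_eq_norm, sub_add_cancel_left, norm_neg, norm_smul, hn, mul_one, Real.norm_eq_abs]
  · refine (Metric.le_infDist ((affineSpan_nonempty ℝ).2 hf.2.1)).2 fun z hz => ?_
    rw [← (mem_affineSpan_facet_iff hK hf).1 hz, ← hndef, ← inner_sub_right]
    refine (abs_real_inner_le_norm _ _).trans_eq ?_
    rw [hn, one_mul, dist_comm, dist_eq_norm]

theorem facetDist_of_mem (hK : IsConvexPolytope K) (hf : f ∈ facets K)
    {y : EuclideanSpace ℝ (Fin d)} (hy : y ∈ K) :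
    facetDist f y = facetOffset K f - ⟪unitOutwardNormal K f, y⟫ := by
  rw [facetDist_eq_abs hK hf, abs_of_nonneg (sub_nonneg.2 (inner_le_facetOffset hK hf hy))]

/-! ### Separation by facets -/

/-- Adding `y` raises the dimension by at most one, so these hulls are finitely many proper affine
subspaces, a null set that cannot cover an open set. The point `z` serves as a generic start for a
segment to `y`. -/
theorem exists_notMem_affineSpan_insert {U S : Set (EuclideanSpace ℝ (Fin d))} (hU : IsOpen U)
    (hUne : U.Nonempty) (hS : S.Finite) (y : EuclideanSpace ℝ (Fin d)) :
    ∃ z ∈ U, ∀ T ⊆ S, Module.finrank ℝ (vectorSpan ℝ T) + 1 < d →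
      z ∉ affineSpan ℝ (insert y T) := by
  set 𝒯 : Set (Set (EuclideanSpace ℝ (Fin d))) :=
    {T | T ⊆ S ∧ Module.finrank ℝ (vectorSpan ℝ T) + 1 < d} with h𝒯
  have hfin : 𝒯.Finite := hS.finite_subsets.subset fun T hT => hT.1
  have hnull : MeasureTheory.volume
      (⋃ T ∈ 𝒯, (affineSpan ℝ (insert y T) : Set (EuclideanSpace ℝ (Fin d)))) = 0 := by
    refine (MeasureTheory.measure_biUnion_null_iff hfin.countable).2 fun T hT => ?_
    refine MeasureTheory.Measure.addHaar_affineSubspace _ _ fun htop => ?_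
    have h1 := finrank_vectorSpan_insert_le_set ℝ T y
    rw [← direction_affineSpan, htop, AffineSubspace.direction_top, finrank_top,
      finrank_euclideanSpace_fin] at h1
    have := hT.2
    omega
  by_contra! hcon
  refine (hU.measure_pos MeasureTheory.volume hUne).ne' (MeasureTheory.measure_mono_null ?_ hnull)
  intro z hz
  obtain ⟨T, hT, hd, hzT⟩ := hcon z hz
  exact Set.mem_biUnion (show T ∈ 𝒯 from ⟨hT, hd⟩) hzT

theorem exists_mem_openSegment_frontier {E : Type*} [NormedAddCommGroup E] [NormedSpace ℝ E]
    {K : Set E} (hK : IsClosed K) {z y : E} (hz : z ∈ interior K) (hy : y ∉ K) :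
    ∃ p ∈ openSegment ℝ z y, p ∈ K ∧ p ∉ interior K := by
  have hpre : IsPreconnected (segment ℝ z y) := (convex_segment z y).isPreconnected
  obtain ⟨p, hp, hpf⟩ : ∃ p ∈ segment ℝ z y, p ∈ K ∧ p ∉ interior K := by
    by_contra! hcon
    obtain ⟨w, -, hw1, hw2⟩ := hpre (interior K) Kᶜ isOpen_interior hK.isOpen_compl
      (fun w hw => (em (w ∈ K)).imp (hcon w hw) id)
      ⟨z, left_mem_segment ℝ z y, hz⟩ ⟨y, right_mem_segment ℝ z y, hy⟩
    exact hw2 (interior_subset hw1)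
  refine ⟨p, mem_openSegment_of_ne_left_right ?_ ?_ hp, hpf⟩
  · rintro rfl
    exact hpf.2 hz
  · rintro rfl
    exact hy hpf.1

/-- An exposed face of the convex hull of a set is the convex hull of the points of the set that
it contains. -/
theorem eq_convexHull_inter_of_isExposed {S : Set (EuclideanSpace ℝ (Fin d))} (hS : S.Finite)
    (hf : IsExposed ℝ (convexHull ℝ S) f) : f = convexHull ℝ (f ∩ S) := by
  have hc : IsCompact (convexHull ℝ S) := hS.isCompact_convexHull (𝕜 := ℝ)
  have hfv : Convex ℝ f := hf.convex (convex_convexHull ℝ S)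
  refine Set.Subset.antisymm ?_ (convexHull_min Set.inter_subset_left hfv)
  have hcl : IsClosed (convexHull ℝ (f ∩ S)) :=
    ((hS.inter_of_right f).isCompact_convexHull (𝕜 := ℝ)).isClosed
  conv_lhs => rw [← closure_convexHull_extremePoints (hf.isCompact hc) hfv]
  refine closure_minimal (convexHull_mono fun x hx => ⟨hx.1, ?_⟩) hcl
  exact extremePoints_convexHull_subset (𝕜 := ℝ)
    (hf.isExtreme.extremePoints_subset_extremePoints hx)

/-- A point outside a polytope is separated from it by one of its facets. -/
theorem exists_facet_of_notMem (hK : IsConvexPolytope K) {y : EuclideanSpace ℝ (Fin d)}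
    (hy : y ∉ K) : ∃ f ∈ facets K, facetOffset K f < ⟪unitOutwardNormal K f, y⟫ := by
  obtain ⟨S, hS, hKS⟩ := hK.exists_finite
  obtain ⟨z, hz, hzT⟩ :=
    exists_notMem_affineSpan_insert isOpen_interior hK.interior_nonempty hS y
  obtain ⟨p, hpzy, hpK, hpint⟩ :=
    exists_mem_openSegment_frontier hK.isCompact.isClosed hz hy
  -- A supporting hyperplane at the exit point `p` exposes a face `f`; the generic choice of `z`
  -- will force `f` to be a facet.
  obtain ⟨l, hl⟩ := geometric_hahn_banach_open_point hK.convex.interior isOpen_interior hpint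
  have hlK : ∀ a ∈ K, l a ≤ l p := by
    have hcl : K ⊆ closure (interior K) := by
      rw [hK.convex.closure_interior_eq_closure_of_nonempty_interior hK.interior_nonempty]
      exact subset_closure
    exact fun a ha => closure_minimal (fun b hb => (hl b hb).le)
      (isClosed_le l.continuous continuous_const) (hcl ha)
  set f := {a ∈ K | ∀ b ∈ K, l b ≤ l a} with hf
  have hexp : IsExposed ℝ K f := fun _ => ⟨l, rfl⟩
  have hpf : p ∈ f := ⟨hpK, hlK⟩
  have hzf : z ∉ f := fun h => (h.2 p hpK).not_gt (hl z hz)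
  obtain ⟨a, b, ha, hb, hab, hp⟩ := hpzy
  have hfacet : f ∈ facets K := by
    refine ⟨hexp, ⟨p, hpf⟩, ?_⟩
    have hle : vectorSpan ℝ f ≤ LinearMap.ker l.toLinearMap := by
      rw [vectorSpan_def, Submodule.span_le]
      rintro _ ⟨u, hu, w, hw, rfl⟩
      simp [le_antisymm (hu.2 w hw.1) (hw.2 u hu.1)]
    have hlt : Module.finrank ℝ (vectorSpan ℝ f) < d := by
      refine (Submodule.finrank_mono hle).trans_lt ?_
      conv_rhs => rw [← finrank_euclideanSpace_fin (𝕜 := ℝ) (n := d)]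
      refine Submodule.finrank_lt fun htop => (hl z hz).ne ?_
      have h0 : ∀ u, l u = 0 := fun u => by
        have : u ∈ LinearMap.ker l.toLinearMap := htop ▸ Submodule.mem_top
        simpa using this
      rw [h0, h0]
    -- If `f` had dimension below `d - 1`, the line through `y` and `p`, which contains `z`, would
    -- lie in a hull that `z` avoids.
    by_contra hne
    have hfS : f = convexHull ℝ (f ∩ S) :=
      eq_convexHull_inter_of_isExposed hS (hKS ▸ hexp)
    refine hzT (f ∩ S) Set.inter_subset_right ?_ ?_
    · have := Submodule.finrank_mono (vectorSpan_mono ℝ (Set.inter_subset_left : f ∩ S ⊆ f))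
      omega
    · have hyA : y ∈ affineSpan ℝ (insert y (f ∩ S)) := mem_affineSpan ℝ (Set.mem_insert _ _)
      have hpA : p ∈ affineSpan ℝ (insert y (f ∩ S)) :=
        affineSpan_mono ℝ (Set.subset_insert _ _)
          (convexHull_subset_affineSpan _ (hfS ▸ hpf))
      have hzl : z = AffineMap.lineMap y p a⁻¹ := by
        have : p - y = a • (z - y) := by
          rw [← hp, eq_sub_of_add_eq' hab, sub_smul, one_smul, smul_sub]
          abel
        rw [AffineMap.lineMap_apply_module', this, smul_smul, inv_mul_cancel₀ ha.ne', one_smul]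
        abel
      rw [hzl]
      exact AffineMap.lineMap_mem _ hyA hpA
  refine ⟨f, hfacet, ?_⟩
  have hzlt : ⟪unitOutwardNormal K f, z⟫ < facetOffset K f :=
    lt_of_le_of_ne (inner_le_facetOffset hK hfacet (interior_subset hz))
      fun h => hzf ((inner_eq_facetOffset_iff hK hfacet (interior_subset hz)).1 h)
  -- At `p`, between `z` and `y`, the normal attains the offset; it is strictly below at `z`, hence
  -- strictly above at `y`.
  have hpe := inner_eq_facetOffset hK hfacet hpf
  rw [← hp, inner_add_right, real_inner_smul_right, real_inner_smul_right] at hpe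
  have h1 : a * ⟪unitOutwardNormal K f, z⟫ < a * facetOffset K f := by gcongr
  have h2 : b * facetOffset K f < b * ⟪unitOutwardNormal K f, y⟫ := by
    have : b * facetOffset K f = facetOffset K f - a * facetOffset K f := by
      rw [eq_sub_of_add_eq' hab]; ring
    linarith
  exact lt_of_mul_lt_mul_left h2 hb.le

/-! ### Vertices generate the polytope -/

/-- With finitely many generators, an extreme point `v` can be strictly separated from the hull of
the others; the separating functional then has `v` as its only maximizer on `K`. -/
theorem extremePoints_subset_vertices (hK : IsConvexPolytope K) :
    K.extremePoints ℝ ⊆ vertices K := by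
  obtain ⟨S, hS, rfl⟩ := hK.exists_finite
  intro v hv
  have hv' := (convex_convexHull ℝ S).mem_extremePoints_iff_mem_sdiff_convexHull_sdiff.1 hv
  have hvS : v ∈ S := extremePoints_convexHull_subset hv
  have hnot : v ∉ convexHull ℝ (S \ {v}) := fun h =>
    hv'.2 (convexHull_mono (Set.sdiff_subset_sdiff_left (subset_convexHull ℝ S)) h)
  obtain ⟨l, u, hlu, huv⟩ := geometric_hahn_banach_closed_point (convex_convexHull ℝ (S \ {v}))
    (hS.sdiff.isCompact_convexHull (𝕜 := ℝ)).isClosed hnot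
  refine ⟨hv.1, l, fun y hy => ?_⟩
  rw [← Set.insert_sdiff_self_of_mem hvS] at hy
  by_cases hne : (S \ {v}).Nonempty
  · rw [convexHull_insert hne, mem_convexJoin] at hy
    obtain ⟨_, rfl, w, hw, a, b, ha, hb, hab, rfl⟩ := hy
    have hw' := (hlu w hw).trans huv
    obtain rfl : a = 1 - b := by linarith
    simp only [map_add, map_smul, smul_eq_mul]
    refine ⟨by nlinarith, fun h => ?_⟩
    have hb0 : b = 0 := by nlinarith
    subst hb0
    simp
  · rw [Set.not_nonempty_iff_eq_empty.1 hne] at hy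
    have : y = v := by simpa using hy
    simp [this]

theorem convexHull_vertices (hK : IsConvexPolytope K) : convexHull ℝ (vertices K) = K := by
  refine Set.Subset.antisymm (convexHull_min (exposedPoints_subset) hK.convex) ?_
  have hcl := (hK.finite_vertices.isCompact_convexHull (𝕜 := ℝ)).isClosed
  conv_lhs => rw [← closure_convexHull_extremePoints hK.isCompact hK.convex]
  exact closure_minimal (convexHull_mono (extremePoints_subset_vertices hK)) hcl

/-! ### Facet distances and convex combinations -/

theorem facetDist_nonneg (f : Set (EuclideanSpace ℝ (Fin d))) (x : EuclideanSpace ℝ (Fin d)) :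
    0 ≤ facetDist f x := Metric.infDist_nonneg

theorem facetDist_eq_zero_iff (hK : IsConvexPolytope K) (hf : f ∈ facets K)
    {y : EuclideanSpace ℝ (Fin d)} (hy : y ∈ K) : facetDist f y = 0 ↔ y ∈ f := by
  rw [facetDist_of_mem hK hf hy, sub_eq_zero, eq_comm, inner_eq_facetOffset_iff hK hf hy]

theorem hStar_nonneg (K : Set (EuclideanSpace ℝ (Fin d))) : 0 ≤ hStar K := by
  -- The convention `sInf ∅ = 0` covers the case of no non-incident pair.
  refine Real.sInf_nonneg ?_
  rintro _ ⟨f, -, v, -, -, rfl⟩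
  exact facetDist_nonneg f v

theorem hStar_le_facetDist (hf : f ∈ facets K) {v : EuclideanSpace ℝ (Fin d)}
    (hv : v ∈ vertices K) (hvf : v ∉ f) : hStar K ≤ facetDist f v := by
  refine csInf_le ⟨0, ?_⟩ ⟨f, hf, v, hv, hvf, rfl⟩
  rintro _ ⟨f, -, v, -, -, rfl⟩
  exact facetDist_nonneg f v

/-- Carathéodory's theorem with respect to the vertices of a polytope; the distance to a facet is
affine on the polytope. -/
theorem exists_vertices_combination (hK : IsConvexPolytope K) {x : EuclideanSpace ℝ (Fin d)}
    (hx : x ∈ K) : ∃ (ι : Type) (_ : Fintype ι) (z : ι → EuclideanSpace ℝ (Fin d)) (w : ι → ℝ),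
      Fintype.card ι ≤ d + 1 ∧ (∀ i, z i ∈ vertices K) ∧ (∀ i, 0 < w i) ∧ ∑ i, w i = 1 ∧
        ∀ f ∈ facets K, facetDist f x = ∑ i, w i * facetDist f (z i) := by
  have hx' := hx
  rw [← convexHull_vertices hK] at hx'
  obtain ⟨ι, _, z, w, hz, hind, hw, hsum, rfl⟩ := eq_pos_convex_span_of_mem_convexHull hx'
  refine ⟨ι, _, z, w, ?_, fun i => hz ⟨i, rfl⟩, hw, hsum, fun f hf => ?_⟩
  · have h1 := hind.card_le_finrank_succ
    have h2 := Submodule.finrank_le (vectorSpan ℝ (Set.range z))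
    rw [finrank_euclideanSpace_fin] at h2
    omega
  · have hzK : ∀ i, z i ∈ K := fun i => exposedPoints_subset (hz ⟨i, rfl⟩)
    simp only [facetDist_of_mem hK hf hx, facetDist_of_mem hK hf (hzK _), mul_sub,
      Finset.sum_sub_distrib, ← Finset.sum_mul, hsum, one_mul, inner_sum, real_inner_smul_right]

/-- Every point of a polytope is far from all the facets avoiding some vertex. -/
theorem exists_vertex_forall_le_facetDist (hK : IsConvexPolytope K)
    {x : EuclideanSpace ℝ (Fin d)} (hx : x ∈ K) :
    ∃ v ∈ vertices K, ∀ f ∈ facets K, v ∉ f → hStar K / ((d : ℝ) + 1) ≤ facetDist f x := by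
  obtain ⟨ι, _, z, w, hcard, hz, hw, hsum, hdist⟩ := exists_vertices_combination hK hx
  have hne : (Finset.univ : Finset ι).Nonempty := by
    by_contra h
    rw [Finset.not_nonempty_iff_eq_empty.1 h] at hsum
    simp at hsum
  obtain ⟨i, -, hi⟩ : ∃ i ∈ Finset.univ, 1 / ((d : ℝ) + 1) ≤ w i := by
    refine Finset.exists_le_of_sum_le hne ?_
    rw [hsum, Finset.sum_const, nsmul_eq_mul, Finset.card_univ, mul_one_div,
      div_le_one (by positivity)]
    exact_mod_cast hcard
  refine ⟨z i, hz i, fun f hf hif => ?_⟩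
  calc hStar K / ((d : ℝ) + 1) = 1 / ((d : ℝ) + 1) * hStar K := by ring
    _ ≤ w i * facetDist f (z i) :=
      mul_le_mul hi (hStar_le_facetDist hf (hz i) hif) (hStar_nonneg K) (hw i).le
    _ ≤ ∑ j, w j * facetDist f (z j) :=
      Finset.single_le_sum (f := fun j => w j * facetDist f (z j))
        (fun j _ => mul_nonneg (hw j).le (facetDist_nonneg _ _)) (Finset.mem_univ i)
    _ = facetDist f x := (hdist f hf).symm

/-! ### Local structure at a vertex -/

/-- The tangent cone of a polytope at a vertex is cut out by the facets at that vertex. -/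
theorem eventually_add_smul_mem (hK : IsConvexPolytope K) {v u : EuclideanSpace ℝ (Fin d)}
    (hv : v ∈ K) (hu : ∀ f ∈ facetsAt K v, ⟪unitOutwardNormal K f, u⟫ ≤ 0) :
    ∀ᶠ ε : ℝ in nhdsWithin 0 (Set.Ioi 0), v + ε • u ∈ K := by
  have key : ∀ᶠ ε : ℝ in nhdsWithin 0 (Set.Ioi 0), ∀ f ∈ facets K,
      ⟪unitOutwardNormal K f, v + ε • u⟫ ≤ facetOffset K f := by
    refine (Filter.eventually_all_finite hK.finite_facets).2 fun f hf => ?_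
    by_cases hvf : v ∈ f
    · filter_upwards [self_mem_nhdsWithin] with ε hε
      rw [inner_add_right, real_inner_smul_right]
      have h1 := mul_nonpos_of_nonneg_of_nonpos (le_of_lt hε) (hu f ⟨hf, hvf⟩)
      have h2 := inner_le_facetOffset hK hf hv
      linarith
    · have hlt : ⟪unitOutwardNormal K f, v⟫ < facetOffset K f :=
        lt_of_le_of_ne (inner_le_facetOffset hK hf hv)
          fun h => hvf ((inner_eq_facetOffset_iff hK hf hv).1 h)
      have hcont : Continuous fun ε : ℝ => ⟪unitOutwardNormal K f, v + ε • u⟫ := by fun_prop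
      have := hcont.tendsto 0
      simp only [zero_smul, add_zero] at this
      exact ((this.eventually (gt_mem_nhds hlt)).filter_mono nhdsWithin_le_nhds).mono
        fun _ h => le_of_lt h
  filter_upwards [key] with ε hε
  by_contra hnot
  obtain ⟨f, hf, hlt⟩ := exists_facet_of_notMem hK hnot
  exact (hε f hf).not_gt hlt

/-- The normals of the facets at a vertex span the whole space. -/
theorem eq_zero_of_forall_inner_eq_zero (hK : IsConvexPolytope K)
    {v u : EuclideanSpace ℝ (Fin d)} (hv : v ∈ vertices K)
    (hu : ∀ f ∈ facetsAt K v, ⟪unitOutwardNormal K f, u⟫ = 0) : u = 0 := by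
  -- Small steps along both `u` and `-u` stay in `K`, so `v` is a midpoint, which extremality allows
  -- only for `u = 0`.
  have hvK : v ∈ K := exposedPoints_subset hv
  obtain ⟨ε, ⟨h1, h2⟩, hε⟩ :=
    (((eventually_add_smul_mem hK hvK fun f hf => (hu f hf).le).and
      (eventually_add_smul_mem (u := -u) hK hvK fun f hf => by
        rw [inner_neg_right, hu f hf, neg_zero])).and self_mem_nhdsWithin).exists
  have hext := exposedPoints_subset_extremePoints (𝕜 := ℝ) hv
  have hmem : v ∈ openSegment ℝ (v + ε • u) (v + ε • -u) := by
    refine ⟨1 / 2, 1 / 2, by norm_num, by norm_num, by norm_num, ?_⟩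
    module
  have := hext.2 h1 h2 hmem
  have h0 : ε • u = 0 := by simpa using this
  exact (smul_eq_zero.1 h0).resolve_left (ne_of_gt hε)

theorem exists_inner_eq_of_vertex (hK : IsConvexPolytope K) {v : EuclideanSpace ℝ (Fin d)}
    (hv : v ∈ vertices K) (e : Fin d ≃ facetsAt K v) (c : Fin d → ℝ) :
    ∃ u, ∀ i, ⟪unitOutwardNormal K (e i : Set (EuclideanSpace ℝ (Fin d))), u⟫ = c i := by
  let L : EuclideanSpace ℝ (Fin d) →ₗ[ℝ] (Fin d → ℝ) :=
    LinearMap.pi fun i => (innerSL ℝ (unitOutwardNormal K (e i : Set _))).toLinearMap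
  have hL : ∀ u i, L u i = ⟪unitOutwardNormal K (e i : Set _), u⟫ := fun u i => by simp [L]
  have hinj : Function.Injective L := by
    refine (injective_iff_map_eq_zero L).2 fun u hu => ?_
    refine eq_zero_of_forall_inner_eq_zero hK hv fun f hf => ?_
    have := hL u (e.symm ⟨f, hf⟩)
    rw [hu, Equiv.apply_symm_apply] at this
    exact this.symm
  obtain ⟨u, hu⟩ :=
    (LinearMap.injective_iff_surjective_of_finrank_eq_finrank (by simp)).1 hinj c
  exact ⟨u, fun i => by rw [← hL, hu]⟩

/-- The neighbour of a vertex along the edge opposite to one of the facets at that vertex. -/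
theorem exists_adjacent_vertex (hK : IsConvexPolytope K) {v : EuclideanSpace ℝ (Fin d)}
    (hv : v ∈ vertices K) (e : Fin d ≃ facetsAt K v) (j : Fin d) :
    ∃ v' ∈ vertices K, v' ∉ (e j : Set (EuclideanSpace ℝ (Fin d))) ∧
      ∀ i, i ≠ j → v' ∈ (e i : Set (EuclideanSpace ℝ (Fin d))) := by
  have hvK : v ∈ K := exposedPoints_subset hv
  -- The direction `u` leaves the facet `e j` inward and stays parallel to the other facets at `v`.
  obtain ⟨u, hu⟩ := exists_inner_eq_of_vertex hK hv e (-Pi.single j 1)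
  have huj : ⟪unitOutwardNormal K (e j : Set (EuclideanSpace ℝ (Fin d))), u⟫ = -1 := by simp [hu]
  have hui : ∀ i, i ≠ j →
      ⟪unitOutwardNormal K (e i : Set (EuclideanSpace ℝ (Fin d))), u⟫ = 0 := fun i hi => by
    simp [hu, hi]
  obtain ⟨ε, hεK, hε⟩ := ((eventually_add_smul_mem hK hvK fun f hf => by
    obtain ⟨i, hi⟩ := e.surjective ⟨f, hf⟩
    have hif : (e i : Set (EuclideanSpace ℝ (Fin d))) = f := by rw [hi]
    rw [← hif]
    by_cases hij : i = j
    · rw [hij, huj]; norm_num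
    · rw [hui i hij]).and self_mem_nhdsWithin).exists
  have hε0 : (0 : ℝ) < ε := hε
  obtain ⟨ι, _, z, w, -, hz, hw, -, hdist⟩ := exists_vertices_combination hK hεK
  have hdy : ∀ i, facetDist (e i : Set (EuclideanSpace ℝ (Fin d))) (v + ε • u)
      = -(ε * ⟪unitOutwardNormal K (e i : Set (EuclideanSpace ℝ (Fin d))), u⟫) := fun i => by
    rw [facetDist_of_mem hK (e i).2.1 hεK, inner_add_right, real_inner_smul_right,
      inner_eq_facetOffset hK (e i).2.1 (e i).2.2]
    ring
  -- A vertex in the combination for `v + ε • u` must be off `e j`. The distances to each other `e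
  -- i` sum to zero with positive weights, so that vertex lies on `e i`.
  obtain ⟨k, -, hk⟩ : ∃ k ∈ Finset.univ,
      0 < w k * facetDist (e j : Set (EuclideanSpace ℝ (Fin d))) (z k) := by
    refine Finset.exists_lt_of_sum_lt (f := fun _ => (0 : ℝ)) ?_
    rw [← hdist _ (e j).2.1, hdy, huj]
    simpa using hε0
  have hzK : ∀ k, z k ∈ K := fun k => exposedPoints_subset (hz k)
  refine ⟨z k, hz k, fun h => ?_, fun i hi => ?_⟩
  · rw [(facetDist_eq_zero_iff hK (e j).2.1 (hzK k)).2 h, mul_zero] at hk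
    exact hk.false
  · have h0 := hdist _ (e i).2.1
    rw [hdy, hui i hi, mul_zero, neg_zero, eq_comm, Finset.sum_eq_zero_iff_of_nonneg
      fun k _ => mul_nonneg (hw k).le (facetDist_nonneg _ _)] at h0
    exact (facetDist_eq_zero_iff hK (e i).2.1 (hzK k)).1
      ((mul_eq_zero.1 (h0 k (Finset.mem_univ k))).resolve_left (hw k).ne')

/-! ### Lower bounds for determinants and weights -/

/-- Hadamard's inequality. -/
theorem abs_det_le_prod_norm (v : Fin d → EuclideanSpace ℝ (Fin d)) :
    |(Matrix.of fun i j => v j i).det| ≤ ∏ j, ‖v j‖ := by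
  let b := EuclideanSpace.basisFun (Fin d) ℝ
  have : Fact (Module.finrank ℝ (EuclideanSpace ℝ (Fin d)) = d) := ⟨finrank_euclideanSpace_fin⟩
  have h := b.toBasis.orientation.abs_volumeForm_apply_le v
  rw [b.toBasis.orientation.volumeForm_robust' b v, Module.Basis.det_apply] at h
  exact h

theorem facetsAt_subset (K : Set (EuclideanSpace ℝ (Fin d))) (v : EuclideanSpace ℝ (Fin d)) :
    facetsAt K v ⊆ facets K := Set.sep_subset _ _

theorem IsSimple.ncard_facetsAt (hs : IsSimple K) {v : EuclideanSpace ℝ (Fin d)}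
    (hv : v ∈ vertices K) : (facetsAt K v).ncard = d := by
  rw [Set.ncard, hs v hv, ENat.toNat_natCast]

theorem nonempty_equiv_facetsAt (hs : IsSimple K) {v : EuclideanSpace ℝ (Fin d)}
    (hv : v ∈ vertices K) : Nonempty (Fin d ≃ facetsAt K v) := by
  have hfin : (facetsAt K v).Finite := Set.finite_of_encard_eq_coe (hs v hv)
  have := hfin.fintype
  refine ⟨(Fintype.equivFinOfCardEq ?_).symm⟩
  rw [← Nat.card_eq_fintype_card, Nat.card_coe_set_eq, hs.ncard_facetsAt hv]

theorem detM_nonneg (K : Set (EuclideanSpace ℝ (Fin d))) (v : EuclideanSpace ℝ (Fin d)) :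
    0 ≤ detM K v := by
  unfold detM
  split_ifs
  · exact abs_nonneg _
  · exact le_rfl

theorem hStar_pow_le_detM_mul (hK : IsConvexPolytope K) (hs : IsSimple K)
    {v : EuclideanSpace ℝ (Fin d)} (hv : v ∈ vertices K) :
    hStar K ^ d ≤ detM K v * Metric.diam K ^ d := by
  obtain ⟨e⟩ := nonempty_equiv_facetsAt hs hv
  have hvK : v ∈ K := exposedPoints_subset hv
  choose z hz hzj hzi using exists_adjacent_vertex hK hv e
  have hzK : ∀ j, z j ∈ K := fun j => exposedPoints_subset (hz j)
  set D : Matrix (Fin d) (Fin d) ℝ := Matrix.of fun i j => (z j - v) i with hD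
  have hinner : ∀ i j, ⟪unitOutwardNormal K (e i : Set (EuclideanSpace ℝ (Fin d))), z j - v⟫
      = -facetDist (e i : Set (EuclideanSpace ℝ (Fin d))) (z j) := fun i j => by
    rw [facetDist_of_mem hK (e i).2.1 (hzK j), inner_sub_right,
      inner_eq_facetOffset hK (e i).2.1 (e i).2.2]
    ring
  -- Off-diagonal entries vanish because `z j` lies on every `e i` with `i ≠ j`.
  have hmul : (normalMatrix K v e).transpose * D = Matrix.diagonal fun j =>
      -facetDist (e j : Set (EuclideanSpace ℝ (Fin d))) (z j) := by
    ext i j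
    have hij : ((normalMatrix K v e).transpose * D) i j =
        ⟪unitOutwardNormal K (e i : Set (EuclideanSpace ℝ (Fin d))), z j - v⟫ := by
      simp only [Matrix.mul_apply, Matrix.transpose_apply, normalMatrix, Matrix.of_apply, hD,
        PiLp.inner_apply, RCLike.inner_apply, conj_trivial]
      exact Finset.sum_congr rfl fun k _ => mul_comm _ _
    rw [hij, hinner]
    by_cases h : i = j
    · rw [h, Matrix.diagonal_apply_eq]
    · rw [Matrix.diagonal_apply_ne _ h,
        (facetDist_eq_zero_iff hK (e i).2.1 (hzK j)).2 (hzi j i h), neg_zero]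
  have hdet := congrArg (fun A => |Matrix.det A|) hmul
  simp only [Matrix.det_mul, Matrix.det_transpose, Matrix.det_diagonal, abs_mul, Finset.abs_prod,
    abs_neg, abs_of_nonneg (facetDist_nonneg _ _), ← detM_eq] at hdet
  calc hStar K ^ d = ∏ _j : Fin d, hStar K := by simp
    _ ≤ ∏ j, facetDist (e j : Set (EuclideanSpace ℝ (Fin d))) (z j) :=
      Finset.prod_le_prod (fun _ _ => hStar_nonneg K)
        fun j _ => hStar_le_facetDist (e j).2.1 (hz j) (hzj j)
    _ = detM K v * |D.det| := hdet.symm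
    _ ≤ detM K v * ∏ j, ‖z j - v‖ :=
      mul_le_mul_of_nonneg_left (abs_det_le_prod_norm fun j => z j - v) (detM_nonneg K v)
    _ ≤ detM K v * ∏ _j : Fin d, Metric.diam K := by
      refine mul_le_mul_of_nonneg_left (Finset.prod_le_prod (fun _ _ => norm_nonneg _)
        fun j _ => ?_) (detM_nonneg K v)
      rw [← dist_eq_norm]
      exact Metric.dist_le_diam_of_mem hK.isCompact.isBounded (hzK j) hvK
    _ = detM K v * Metric.diam K ^ d := by simp

theorem weight_nonneg (K : Set (EuclideanSpace ℝ (Fin d))) (v x : EuclideanSpace ℝ (Fin d)) :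
    0 ≤ weight K v x :=
  mul_nonneg (detM_nonneg K v)
    (finprod_nonneg fun _ => finprod_nonneg fun _ => facetDist_nonneg _ _)

theorem weight_le_wachspressW (hK : IsConvexPolytope K) {v : EuclideanSpace ℝ (Fin d)}
    (hv : v ∈ vertices K) (x : EuclideanSpace ℝ (Fin d)) : weight K v x ≤ wachspressW K x := by
  rw [wachspressW, finsum_mem_eq_finite_toFinset_sum _ hK.finite_vertices]
  exact Finset.single_le_sum (f := fun v => weight K v x) (fun v _ => weight_nonneg K v x)
    (hK.finite_vertices.mem_toFinset.2 hv)

theorem detM_mul_pow_le_weight (hK : IsConvexPolytope K) (hs : IsSimple K)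
    {v x : EuclideanSpace ℝ (Fin d)} (hv : v ∈ vertices K) {r : ℝ} (hr : 0 ≤ r)
    (h : ∀ f ∈ facets K, v ∉ f → r ≤ facetDist f x) :
    detM K v * r ^ ((facets K).ncard - d) ≤ weight K v x := by
  refine mul_le_mul_of_nonneg_left ?_ (detM_nonneg K v)
  have hfin : (facets K \ facetsAt K v).Finite := hK.finite_facets.sdiff
  have hcard : hfin.toFinset.card = (facets K).ncard - d := by
    rw [← Set.ncard_eq_toFinset_card _ hfin, Set.ncard_sdiff (facetsAt_subset K v)
      (hK.finite_facets.subset (facetsAt_subset K v)), hs.ncard_facetsAt hv]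
  rw [finprod_mem_eq_finite_toFinset_prod _ hfin, ← hcard, ← Finset.prod_const]
  refine Finset.prod_le_prod (fun _ _ => hr) fun f hf => ?_
  rw [hfin.mem_toFinset] at hf
  exact h f hf.1 fun hvf => hf.2 ⟨hf.1, hvf⟩

end WachspressPolytope

end

open WachspressPolytope in
theorem mainTheorem3 (d : ℕ) (hd : 1 ≤ d) (K : Set (EuclideanSpace ℝ (Fin d)))
    (hK : WachspressPolytope.IsConvexPolytope K)
    (hnd : WachspressPolytope.IsNondegenerate K)
    (hs : WachspressPolytope.IsSimple K)
    (x : EuclideanSpace ℝ (Fin d)) (hx : x ∈ K) :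
    WachspressPolytope.hStar K ^ (WachspressPolytope.facets K).ncard /
        (((d : ℝ) + 1) ^ ((WachspressPolytope.facets K).ncard - d) * Metric.diam K ^ d)
      ≤ WachspressPolytope.wachspressW K x ∧
    {f ∈ WachspressPolytope.facets K | WachspressPolytope.facetDist f x <
        WachspressPolytope.hStar K / ((d : ℝ) + 1)}.encard ≤ d ∧
    ∃ v ∈ WachspressPolytope.vertices K, ∀ f ∈ WachspressPolytope.facets K,
      WachspressPolytope.facetDist f x < WachspressPolytope.hStar K / ((d : ℝ) + 1) → v ∈ f := by
  obtain ⟨v, hv, hfar⟩ := exists_vertex_forall_le_facetDist hK hx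
  have hnear : ∀ f ∈ facets K, facetDist f x < hStar K / ((d : ℝ) + 1) → v ∈ f :=
    fun f hf hlt => by_contra fun hvf => (hfar f hf hvf).not_gt hlt
  refine ⟨?_, ?_, v, hv, hnear⟩
  · have hr : 0 ≤ hStar K / ((d : ℝ) + 1) := div_nonneg (hStar_nonneg K) (by positivity)
    -- This makes the natural-number subtraction in the exponent a true one.
    have hle : d ≤ (facets K).ncard := (hs.ncard_facetsAt hv).symm.trans_le
      (Set.ncard_le_ncard (facetsAt_subset K v) hK.finite_facets)
    refine le_trans ?_ ((detM_mul_pow_le_weight hK hs hv hr hfar).trans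
      (weight_le_wachspressW hK hv x))
    -- Only nonnegativity of the denominator is needed, so the diameter need not be shown positive.
    refine div_le_of_le_mul₀ (by positivity [Metric.diam_nonneg (s := K)])
      (mul_nonneg (detM_nonneg K v) (pow_nonneg hr _)) ?_
    calc hStar K ^ (facets K).ncard
        = hStar K ^ ((facets K).ncard - d) * hStar K ^ d := by
          rw [← pow_add, Nat.sub_add_cancel hle]
      _ ≤ hStar K ^ ((facets K).ncard - d) * (detM K v * Metric.diam K ^ d) :=
          mul_le_mul_of_nonneg_left (hStar_pow_le_detM_mul hK hs hv)
            (pow_nonneg (hStar_nonneg K) _)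
      _ = detM K v * (hStar K / ((d : ℝ) + 1)) ^ ((facets K).ncard - d) *
          (((d : ℝ) + 1) ^ ((facets K).ncard - d) * Metric.diam K ^ d) := by
          rw [div_pow]
          field_simp
  · rw [← hs v hv]
    exact Set.encard_le_encard fun f hf => ⟨hf.1, hnear f hf.1 hf.2⟩
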